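/- Let $Z$ be a real Banach space and let $1\le\lambda<2$. Suppose that $Z$ has an extended $\lambda$-approximative basis, that is, there is a net $(P_\alpha)_{\alpha\in\mathscr D}$ of bounded linear operators of finite rank on $Z$, indexed by a nonempty directed set $\mathscr D$, such that $\lim_{\alpha}P_\alpha x=x$ for every $x\in Z$ and $\|P_\alpha\|\le\lambda$ for every $\alpha\in\mathscr D$. For a subset $C$ of a normed space, a nonexpansive map $T\colon C\to C$ (i.e. $\|Tx-Ty\|\le\|x-y\|$ for all $x,y\in C$) is called $\mathfrak{cm}$-nonexpansive if \[ \limsup_{i\to\infty}\ \sup_{A\subset\{1,\dots,n\}}\Big\|\sum_{k\in A}(Tu_{i+k}-Ty)\Big\|\ \le\ \limsup_{i\to\infty}\ \sup_{A\subset\{1,\dots,n\}}\Big\|\sum_{k\in A}(u_{i+k}-y)\Big\| \] for all $n\in\mathbb N$, all $y\in C$ and all sequences $(u_i)$ in $C$. Let $X$ be a linear subspace of $Z$ that fails the weak fixed point property for $\mathfrak{cm}$-nonexpansive maps: there are a nonempty weakly compact convex set $C\subset X$ and a $\mathfrak{cm}$-nonexpansive map $T\colon C\to C$ without a fixed point.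 Then $X$ has a spreading model isomorphic to $\ell_1$. That is, there are a bounded sequence in $X$ with a subsequence $(x_i)$, a seminormed space $(E,|||\cdot|||)$ and a sequence $(e_i)$ in $E$ with dense linear span such that for all $n\in\mathbb N$ and $\varepsilon>0$ there is $n_0$ with \[ \Big|\,\Big\|\sum_{i=1}^n a_ix_{\kappa_i}\Big\|-\Big|\Big|\Big|\sum_{i=1}^n a_ie_i\Big|\Big|\Big|\,\Big|<\varepsilon \] whenever $n_0\le\kappa_1<\dots<\kappa_n$ and $a_1,\dots,a_n\in[-1,1]$, and there is a linear homeomorphism of $E$ onto $\ell_1$ that takes $(e_i)$ to the unit vector basis of $\ell_1$. -/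

import Mathlib

open Filter Topology
open scoped ENNReal

/-- A net `(P α)` of finite rank operators on `Z`, indexed by a directed set, is an extended
`lam`-approximative basis of `Z` (`lam`-EAB, `lam ≥ 1`) if it converges pointwise to the identity
and `‖P α‖ ≤ lam` for all `α`. -/
structure IsExtendedApproximativeBasis {Z : Type*} [NormedAddCommGroup Z] [NormedSpace ℝ Z]
    {D : Type*} [Preorder D] (P : D → Z →L[ℝ] Z) (lam : ℝ) : Prop where
  one_le : 1 ≤ lam
  finite_rank : ∀ α, FiniteDimensional ℝ (LinearMap.range (P α : Z →ₗ[ℝ] Z))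
  tendsto : ∀ x : Z, Tendsto (fun α => P α x) atTop (𝓝 x)
  norm_le : ∀ α, ‖P α‖ ≤ lam

/-- A nonexpansive map `T : C → C` is `𝔠𝔪`-nonexpansive if for all `n`, all `y ∈ C` and all
sequences `(u_i)` in `C`,
`limsup_i sup_{A ⊆ {1,…,n}} ‖∑_{k ∈ A} (T u_{i+k} - T y)‖`
is at most `limsup_i sup_{A ⊆ {1,…,n}} ‖∑_{k ∈ A} (u_{i+k} - y)‖`.
The norms are taken in `[0,∞]`, so that all suprema and upper limits exist. -/
def IsCMNonexpansive {X : Type*} [NormedAddCommGroup X] {C : Set X} (T : C → C) : Prop :=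
  LipschitzWith 1 T ∧
    ∀ (n : ℕ) (y : C) (u : ℕ → C),
      limsup (fun i : ℕ => ⨆ A ∈ (Finset.Icc 1 n).powerset,
          ‖∑ k ∈ A, ((T (u (i + k)) : X) - (T y : X))‖ₑ) atTop ≤
        limsup (fun i : ℕ => ⨆ A ∈ (Finset.Icc 1 n).powerset,
          ‖∑ k ∈ A, ((u (i + k) : X) - (y : X))‖ₑ) atTop

/-- The weak fixed point property for `𝔠𝔪`-nonexpansive maps: on every nonempty weakly compact
convex subset `C` of `X`, every `𝔠𝔪`-nonexpansive map `T : C → C` has a fixed point. -/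
def HasWeakFPPForCMNonexpansive (X : Type*) [NormedAddCommGroup X] [NormedSpace ℝ X] : Prop :=
  ∀ C : Set X, C.Nonempty → Convex ℝ C → IsCompact (toWeakSpace ℝ X '' C) →
    ∀ T : C → C, IsCMNonexpansive T → ∃ x : C, T x = x

/-- The asymptotic norm of the sequence `(x_i)` in `X` is that of the sequence `(e_i)` in `E`:
for all `n` and `ε > 0` there is `n₀` such that for all `n₀ ≤ κ₁ < ⋯ < κ_n` and all
`a ∈ [-1, 1]ⁿ`, the norms of `∑ a_i x_{κ_i}` and `∑ a_i e_i` differ by less than `ε`. -/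
def AsymptoticallyGenerates {X E : Type*} [NormedAddCommGroup X] [NormedSpace ℝ X]
    [SeminormedAddCommGroup E] [NormedSpace ℝ E] (x : ℕ → X) (e : ℕ → E) : Prop :=
  ∀ (n : ℕ) (ε : ℝ), 0 < ε → ∃ n₀ : ℕ, ∀ κ : Fin n → ℕ, StrictMono κ → (∀ i, n₀ ≤ κ i) →
    ∀ a : Fin n → ℝ, (∀ i, a i ∈ Set.Icc (-1 : ℝ) 1) →
      |‖∑ i, a i • x (κ i)‖ - ‖∑ i, a i • e i‖| < ε

/-- The seminormed space `E` with fundamental sequence `(e_i)` is a spreading model of `X`: some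
bounded sequence in `X` has a subsequence generating `(e_i)`, and the linear span of `(e_i)` is
dense in `E`. -/
def IsSpreadingModel (X : Type*) [NormedAddCommGroup X] [NormedSpace ℝ X]
    {E : Type*} [SeminormedAddCommGroup E] [NormedSpace ℝ E] (e : ℕ → E) : Prop :=
  (Submodule.span ℝ (Set.range e)).topologicalClosure = ⊤ ∧
    ∃ x : ℕ → X, Bornology.IsBounded (Set.range x) ∧
      ∃ φ : ℕ → ℕ, StrictMono φ ∧ AsymptoticallyGenerates (x ∘ φ) e

/-- `X` has a spreading model isomorphic to `ℓ₁`: there are a spreading model `E` of `X`, with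
fundamental sequence `(e_i)`, and a linear isomorphism of `E` onto `ℓ₁` that is continuous with
its inverse and takes `(e_i)` to the unit vector basis of `ℓ₁`. -/
def HasSpreadingModelIsomorphicToL1 (X : Type*) [NormedAddCommGroup X] [NormedSpace ℝ X] : Prop :=
  ∃ (E : Type) (_ : SeminormedAddCommGroup E) (_ : NormedSpace ℝ E) (e : ℕ → E),
    IsSpreadingModel X e ∧
      ∃ Φ : E ≃L[ℝ] lp (fun _ : ℕ => ℝ) 1, ∀ i : ℕ, Φ (e i) = lp.single 1 i (1 : ℝ)

/-! Suppose `T` has no fixed point. Zorn's lemma gives a minimal closed convex invariant set `K`,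
and `K` contains approximate fixed points `u i`; pass to a subsequence converging weakly to some
`z`. For fixed `n` and `c`, the points `y` satisfying `AsymptoticSumBound u n c y` form a closed
convex set whose trace on `K` is invariant: this is where the `𝔠𝔪` condition enters. If `z` lies in
it, minimality puts `T z` in it too, and a norming functional gives `n * ‖z - T z‖ ≤ c`. Hence `u i
- z` is weakly null, and along every subsequence its subset sums over `n` consecutive terms
recurrently reach `n * δ`, with `δ = ‖z - T z‖ / 2` (`exists_weaklyNull_of_not_hasWeakFPP`).

A Ramsey argument extracts a subsequence that generates a spreading seminorm `p` on `ℓ₁`. Weak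
nullness makes `p` decrease when coefficients are deleted (`Seminorm.IsGeneratedBy.update_zero_le`),
so `p (e 0 + ⋯ + e (n - 1)) ≥ n * δ`. Averaging translates gives `p (∑ a i • e i) ≥ δ * ∑ a i` for
`a ≥ 0`, and splitting by signs gives `δ / 2 * ∑ |a i|` in general. Boundedness of the sequence
gives the upper `ℓ₁`-estimate. -/

/-! ### Weak compactness, minimal invariant sets and approximate fixed points -/

section WeaklyCompact

variable {X : Type*} [NormedAddCommGroup X] [NormedSpace ℝ X]

theorem continuous_toWeakSpace : Continuous (toWeakSpace ℝ X) :=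
  (toWeakSpaceCLM ℝ X).continuous

theorem continuous_dual_toWeakSpace_symm (f : StrongDual ℝ X) :
    Continuous fun x : WeakSpace ℝ X => f ((toWeakSpace ℝ X).symm x) :=
  WeakBilin.eval_continuous (topDualPairing ℝ X).flip f

theorem isClosed_of_isCompact_toWeakSpace {K : Set X} (hK : IsCompact (toWeakSpace ℝ X '' K)) :
    IsClosed K := by
  have := hK.isClosed.preimage (continuous_toWeakSpace (X := X))
  rwa [Set.preimage_image_eq _ (toWeakSpace ℝ X).injective] at this

theorem Convex.isClosed_toWeakSpace {K : Set X} (hc : Convex ℝ K) (hK : IsClosed K) :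
    IsClosed (toWeakSpace ℝ X '' K) := by
  have := hc.toWeakSpace_closure ℝ
  rw [hK.closure_eq] at this
  rw [this]
  exact isClosed_closure

/-- Uniform boundedness, applied to `K` embedded in the bidual; the operators live on the dual,
which is always complete. -/
theorem exists_norm_le_of_isCompact_toWeakSpace {K : Set X}
    (hK : IsCompact (toWeakSpace ℝ X '' K)) : ∃ R, ∀ x ∈ K, ‖x‖ ≤ R := by
  obtain ⟨R, hR⟩ := banach_steinhaus
    (g := fun x : K => NormedSpace.inclusionInDoubleDual ℝ X (x : X)) (fun f => by
      obtain ⟨R, hR⟩ := (hK.image (continuous_dual_toWeakSpace_symm f)).isBounded.exists_norm_le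
      refine ⟨R, fun x => ?_⟩
      have := hR (f x) ⟨toWeakSpace ℝ X x, ⟨x, x.2, rfl⟩, by simp⟩
      simpa using this)
  refine ⟨R, fun x hx => ?_⟩
  have := hR ⟨x, hx⟩
  rwa [show ‖NormedSpace.inclusionInDoubleDual ℝ X x‖ = ‖x‖ from
    (NormedSpace.inclusionInDoubleDualLi ℝ (E := X)).norm_map x] at this

/-- A nonempty weakly compact convex set that is invariant under `S` contains a minimal nonempty
closed convex invariant set. -/
theorem exists_minimal_invariant {C : Set X} (hne : C.Nonempty) (hconv : Convex ℝ C)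
    (hcomp : IsCompact (toWeakSpace ℝ X '' C)) {S : X → X} (hS : Set.MapsTo S C C) :
    ∃ K ⊆ C, K.Nonempty ∧ Convex ℝ K ∧ IsClosed K ∧ Set.MapsTo S K K ∧
      ∀ K' ⊆ K, K'.Nonempty → Convex ℝ K' → IsClosed K' → Set.MapsTo S K' K' → K' = K := by
  obtain ⟨K, hKC, hK⟩ := zorn_superset_nonempty
    {K : Set X | K ⊆ C ∧ K.Nonempty ∧ Convex ℝ K ∧ IsClosed K ∧ Set.MapsTo S K K} (by
      intro c hc hchain hcne
      refine ⟨⋂₀ c, ⟨?_, ?_, ?_, ?_, ?_⟩, fun s hs => Set.sInter_subset_of_mem hs⟩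
      · obtain ⟨s, hs⟩ := hcne
        exact (Set.sInter_subset_of_mem hs).trans (hc hs).1
      · have : Nonempty c := hcne.to_subtype
        have key : (⋂ s : c, toWeakSpace ℝ X '' (s : Set X)).Nonempty := by
          refine IsCompact.nonempty_iInter_of_directed_nonempty_isCompact_isClosed _ ?_ ?_ ?_ ?_
          · rintro ⟨s, hs⟩ ⟨t, ht⟩
            rcases hchain.total hs ht with h | h
            · exact ⟨⟨s, hs⟩, subset_rfl, Set.image_mono h⟩
            · exact ⟨⟨t, ht⟩, Set.image_mono h, subset_rfl⟩
          · exact fun s => (hc s.2).2.1.image _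
          · exact fun s => hcomp.of_isClosed_subset
              ((hc s.2).2.2.1.isClosed_toWeakSpace (hc s.2).2.2.2.1) (Set.image_mono (hc s.2).1)
          · exact fun s => (hc s.2).2.2.1.isClosed_toWeakSpace (hc s.2).2.2.2.1
        obtain ⟨x, hx⟩ := key
        refine ⟨(toWeakSpace ℝ X).symm x, fun s hs => ?_⟩
        obtain ⟨y, hy, hyx⟩ := Set.mem_iInter.1 hx ⟨s, hs⟩
        rw [← hyx]
        simpa using hy
      · exact convex_sInter fun s hs => (hc hs).2.2.1
      · exact isClosed_sInter fun s hs => (hc hs).2.2.2.1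
      · exact fun x hx s hs => (hc hs).2.2.2.2 (hx s hs)) C
    ⟨subset_rfl, hne, hconv, isClosed_of_isCompact_toWeakSpace hcomp, hS⟩
  refine ⟨K, hK.1.1, hK.1.2.1, hK.1.2.2.1, hK.1.2.2.2.1, hK.1.2.2.2.2, ?_⟩
  intro K' hK' h1 h2 h3 h4
  exact subset_antisymm hK' (hK.2 ⟨hK'.trans hK.1.1, h1, h2, h3, h4⟩ hK')

/-- Damping `S` towards a fixed `z` gives a strict contraction `G` that differs from `S` by at most
`t * (2 * R)` on `K`. Consecutive iterates of `G` become close, so a late iterate serves without a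
fixed point of `G`. -/
theorem exists_norm_sub_lt_of_nonexpansive {K : Set X} (hne : K.Nonempty) (hconv : Convex ℝ K)
    {R : ℝ} (hR : ∀ x ∈ K, ‖x‖ ≤ R) {S : X → X} (hS : Set.MapsTo S K K)
    (hlip : ∀ x ∈ K, ∀ y ∈ K, ‖S x - S y‖ ≤ ‖x - y‖) {ε : ℝ} (hε : 0 < ε) :
    ∃ x ∈ K, ‖S x - x‖ < ε := by
  obtain ⟨z, hz⟩ := hne
  have hR0 : 0 ≤ R := (norm_nonneg _).trans (hR z hz)
  have hdiam : ∀ x ∈ K, ∀ y ∈ K, ‖x - y‖ ≤ 2 * R := fun x hx y hy =>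
    (norm_sub_le x y).trans (by linarith [hR x hx, hR y hy])
  obtain ⟨t, ht0, ht1, htR⟩ : ∃ t : ℝ, 0 < t ∧ t < 1 ∧ t * (2 * R) < ε / 2 := by
    refine ⟨min (1 / 2) (ε / (4 * (2 * R + 1))), by positivity,
      (min_le_left _ _).trans_lt (by norm_num), ?_⟩
    have h1 : min (1 / 2) (ε / (4 * (2 * R + 1))) * (2 * R + 1) ≤ ε / 4 := by
      calc _ ≤ ε / (4 * (2 * R + 1)) * (2 * R + 1) := by gcongr; exact min_le_right _ _
        _ = ε / 4 := by field_simp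
    have h2 : 0 < min (1 / 2) (ε / (4 * (2 * R + 1))) := by positivity
    nlinarith
  let G : X → X := fun x => (1 - t) • S x + t • z
  have hG : Set.MapsTo G K K := fun x hx => hconv (hS hx) hz (by linarith) ht0.le (by ring)
  have hGn : ∀ n, G^[n] z ∈ K := fun n => hG.iterate n hz
  have hit : ∀ n, ‖G^[n + 1] z - G^[n] z‖ ≤ (1 - t) ^ n * (2 * R) := by
    intro n
    induction n with
    | zero => simpa using hdiam _ (hG hz) _ hz
    | succ n ih =>
      rw [Function.iterate_succ_apply' G (n + 1), Function.iterate_succ_apply' G n]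
      rw [Function.iterate_succ_apply' G n] at ih
      have : G (G (G^[n] z)) - G (G^[n] z) = (1 - t) • (S (G (G^[n] z)) - S (G^[n] z)) := by
        simp only [G, smul_sub]; abel
      rw [this, norm_smul, Real.norm_of_nonneg (by linarith), pow_succ', mul_assoc]
      exact mul_le_mul_of_nonneg_left ((hlip _ (hG (hGn n)) _ (hGn n)).trans ih) (by linarith)
  obtain ⟨n, hn⟩ : ∃ n : ℕ, (1 - t) ^ n * (2 * R) < ε / 2 := by
    have : Tendsto (fun n : ℕ => (1 - t) ^ n * (2 * R)) atTop (𝓝 (0 * (2 * R))) :=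
      (tendsto_pow_atTop_nhds_zero_of_lt_one (by linarith) (by linarith)).mul_const _
    rw [zero_mul] at this
    exact (this.eventually (gt_mem_nhds (by positivity))).exists
  refine ⟨G^[n] z, hGn n, ?_⟩
  have h1 := hit n
  rw [Function.iterate_succ_apply' G n] at h1
  set x := G^[n] z with hx
  have h2 : S x - x = t • (S x - z) + (G x - x) := by
    simp only [G, smul_sub, sub_smul, one_smul]; abel
  rw [h2]
  calc _ ≤ ‖t • (S x - z)‖ + ‖G x - x‖ := norm_add_le _ _
    _ ≤ t * (2 * R) + (1 - t) ^ n * (2 * R) := by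
      rw [norm_smul, Real.norm_of_nonneg ht0.le]
      gcongr
      exact hdiam _ (hS (hGn n)) _ hz
    _ < ε := by linarith

/-- Weakly compact sets are weakly sequentially compact. -/
theorem exists_subseq_weakly_tendsto {K : Set X} (hK : IsCompact (toWeakSpace ℝ X '' K))
    {u : ℕ → X} (hu : ∀ i, u i ∈ K) :
    ∃ z ∈ K, ∃ φ : ℕ → ℕ, StrictMono φ ∧
      ∀ f : StrongDual ℝ X, Tendsto (fun i => f (u (φ i))) atTop (𝓝 (f z)) := by
  let Y : Submodule ℝ X := (Submodule.span ℝ (Set.range u)).topologicalClosure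
  have hYsep : TopologicalSpace.IsSeparable (Y : Set X) := by
    have : TopologicalSpace.IsSeparable (Submodule.span ℝ (Set.range u) : Set X) :=
      (Set.countable_range u).isSeparable.span
    simpa [Y, Submodule.topologicalClosure_coe] using this.closure
  have hYcl : IsClosed (Y : Set X) := Submodule.isClosed_topologicalClosure _
  have huY : ∀ i, u i ∈ Y := fun i =>
    Submodule.le_topologicalClosure _ (Submodule.subset_span ⟨i, rfl⟩)
  obtain ⟨c, hc, hcY⟩ := hYsep
  have hfun : ∀ d : X, ∃ f : StrongDual ℝ X, ‖f‖ ≤ 1 ∧ f d = ‖d‖ := fun d =>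
    exists_dual_vector'' ℝ d
  choose F hF1 hF2 using hfun
  -- Norming functionals of a countable set approximating `Y` separate the points of `Y`: if `d` is
  -- within `‖v‖ / 2` of `v` and `F d v = 0`, then `‖d‖ ≤ ‖d - v‖`, which contradicts the triangle
  -- inequality unless `v = 0`.
  have hsepar : ∀ v ∈ Y, (∀ d ∈ c, F d v = 0) → v = 0 := by
    intro v hv h0
    by_contra hne
    have hpos : 0 < ‖v‖ := norm_pos_iff.2 hne
    obtain ⟨d, hd, hvd⟩ := Metric.mem_closure_iff.1 (hcY hv) (‖v‖ / 2) (by positivity)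
    have h1 : ‖d‖ ≤ ‖d - v‖ := by
      calc ‖d‖ = F d (d - v) := by rw [map_sub, h0 d hd, hF2, sub_zero]
        _ ≤ ‖F d (d - v)‖ := le_abs_self _
        _ ≤ 1 * ‖d - v‖ := (F d).le_of_opNorm_le (hF1 d) _
        _ = _ := one_mul _
    have h2 : ‖v‖ ≤ ‖v - d‖ + ‖d‖ := by simpa using norm_add_le (v - d) d
    rw [dist_eq_norm] at hvd
    rw [norm_sub_rev] at h1
    linarith
  -- The functionals `F d` embed this compact set into the metrizable space `c → ℝ`, so it is
  -- sequentially compact.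
  let K' : Set (WeakSpace ℝ X) := toWeakSpace ℝ X '' K ∩ toWeakSpace ℝ X '' (Y : Set X)
  have hK' : IsCompact K' := hK.inter_right (Y.convex.isClosed_toWeakSpace hYcl)
  have : CompactSpace K' := isCompact_iff_compactSpace.1 hK'
  have : Countable c := hc.to_subtype
  let g : K' → c → ℝ := fun x d => F d ((toWeakSpace ℝ X).symm x)
  have hg : Continuous g := continuous_pi fun d =>
    (continuous_dual_toWeakSpace_symm (F d)).comp continuous_subtype_val
  have hginj : Function.Injective g := by
    rintro ⟨x, hxK, x', hx', rfl⟩ ⟨y, hyK, y', hy', rfl⟩ h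
    have : x' - y' = 0 := hsepar _ (Y.sub_mem hx' hy') fun d hd => by
      have := congrFun h ⟨d, hd⟩
      simp only [g, LinearEquiv.symm_apply_apply] at this
      rw [map_sub, this, sub_self]
    simp [sub_eq_zero.1 this]
  have hemb := (hg.isClosedEmbedding hginj).isEmbedding
  have : FirstCountableTopology K' := hemb.isInducing.firstCountableTopology
  obtain ⟨z, φ, hφ, hz⟩ := CompactSpace.tendsto_subseq
    (fun i => (⟨toWeakSpace ℝ X (u i), ⟨u i, hu i, rfl⟩, ⟨u i, huY i, rfl⟩⟩ : K'))
  obtain ⟨z, ⟨z', hz'K, rfl⟩, hzY⟩ := z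
  refine ⟨z', hz'K, φ, hφ, fun f => ?_⟩
  have := (((continuous_dual_toWeakSpace_symm f).comp continuous_subtype_val).tendsto _).comp hz
  simpa [Function.comp_def] using this

end WeaklyCompact

/-! ### Asymptotic subset sums and the `𝔠𝔪` condition -/

section CMNonexpansive

variable {X : Type*} [NormedAddCommGroup X]

/-- The real number `c` is an asymptotic bound for the norms of the sums of `u (i + k) - y` over
the subsets of `{1, …, n}`. -/
def AsymptoticSumBound (u : ℕ → X) (n : ℕ) (c : ℝ) (y : X) : Prop :=
  ∀ ε : ℝ, 0 < ε → ∀ᶠ i in atTop, ∀ A ⊆ Finset.Icc 1 n, ‖∑ k ∈ A, (u (i + k) - y)‖ ≤ c + ε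

theorem IsCMNonexpansive.asymptoticSumBound {C : Set X} {T : C → C} (hT : IsCMNonexpansive T)
    {u : ℕ → C} {y : C} {n : ℕ} {c : ℝ} (hc : 0 ≤ c)
    (h : AsymptoticSumBound (fun i => (u i : X)) n c y) :
    AsymptoticSumBound (fun i => (T (u i) : X)) n c (T y) := by
  intro ε hε
  have h1 : limsup (fun i : ℕ => ⨆ A ∈ (Finset.Icc 1 n).powerset,
      ‖∑ k ∈ A, ((u (i + k) : X) - (y : X))‖ₑ) atTop ≤ ENNReal.ofReal (c + ε / 2) := by
    refine limsup_le_of_le (by isBoundedDefault) ?_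
    filter_upwards [h (ε / 2) (by positivity)] with i hi
    refine iSup₂_le fun A hA => ?_
    rw [← ofReal_norm]
    exact ENNReal.ofReal_le_ofReal (hi A (Finset.mem_powerset.1 hA))
  have h2 := ((hT.2 n y u).trans h1).trans_lt
    ((ENNReal.ofReal_lt_ofReal_iff (q := c + ε) (by positivity)).2 (by linarith))
  filter_upwards [eventually_lt_of_limsup_lt h2] with i hi A hA
  have h3 := (le_iSup₂ (f := fun A (_ : A ∈ (Finset.Icc 1 n).powerset) =>
    ‖∑ k ∈ A, ((T (u (i + k)) : X) - (T y : X))‖ₑ) A (Finset.mem_powerset.2 hA)).trans_lt hi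
  rw [← ofReal_norm] at h3
  exact (ENNReal.ofReal_lt_ofReal_iff (by positivity)).1 h3 |>.le

theorem AsymptoticSumBound.of_tendsto_sub {u v : ℕ → X} {n : ℕ} {c : ℝ} {y : X}
    (h : AsymptoticSumBound u n c y) (huv : Tendsto (fun i => v i - u i) atTop (𝓝 0)) :
    AsymptoticSumBound v n c y := by
  intro ε hε
  have h1 : ∀ᶠ i in atTop, ‖v i - u i‖ < ε / (2 * (n + 1)) := by
    have := huv.norm
    rw [norm_zero] at this
    exact this.eventually (gt_mem_nhds (by positivity))
  obtain ⟨N, hN⟩ := eventually_atTop.1 h1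
  filter_upwards [h (ε / 2) (by positivity), eventually_ge_atTop N] with i hi hiN A hA
  have h2 : ∑ k ∈ A, (v (i + k) - y)
      = ∑ k ∈ A, (u (i + k) - y) + ∑ k ∈ A, (v (i + k) - u (i + k)) := by
    rw [← Finset.sum_add_distrib]
    exact Finset.sum_congr rfl fun k _ => by abel
  have h3 : ‖∑ k ∈ A, (v (i + k) - u (i + k))‖ ≤ ε / 2 := by
    calc _ ≤ ∑ k ∈ A, ‖v (i + k) - u (i + k)‖ := norm_sum_le _ _
      _ ≤ ∑ _k ∈ A, ε / (2 * (n + 1)) := Finset.sum_le_sum fun k _ => (hN _ (by omega)).le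
      _ = A.card * (ε / (2 * (n + 1))) := by simp
      _ ≤ (n + 1) * (ε / (2 * (n + 1))) := by
        have : A.card ≤ n := by simpa using Finset.card_le_card hA
        gcongr
        exact_mod_cast this.trans n.le_succ
      _ = ε / 2 := by field_simp
  rw [h2]
  exact (norm_add_le _ _).trans (by linarith [hi A hA])

theorem isClosed_asymptoticSumBound (u : ℕ → X) (n : ℕ) (c : ℝ) :
    IsClosed {y | AsymptoticSumBound u n c y} := by
  refine isClosed_of_closure_subset fun y hy ε hε => ?_
  obtain ⟨y', hy', hyy'⟩ := Metric.mem_closure_iff.1 hy (ε / (2 * (n + 1))) (by positivity)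
  rw [dist_eq_norm] at hyy'
  filter_upwards [hy' (ε / 2) (by positivity)] with i hi A hA
  have h2 : ∑ k ∈ A, (u (i + k) - y) = ∑ k ∈ A, (u (i + k) - y') - A.card • (y - y') := by
    rw [← Finset.sum_const, ← Finset.sum_sub_distrib]
    exact Finset.sum_congr rfl fun k _ => by abel
  have h3 : ‖A.card • (y - y')‖ ≤ ε / 2 := by
    calc _ ≤ A.card * ‖y - y'‖ := norm_nsmul_le
      _ ≤ (n + 1) * (ε / (2 * (n + 1))) := by
        have : A.card ≤ n := by simpa using Finset.card_le_card hA
        gcongr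
        exact_mod_cast this.trans n.le_succ
      _ = ε / 2 := by field_simp
  rw [h2]
  exact (norm_sub_le _ _).trans (by linarith [hi A hA])

variable [NormedSpace ℝ X]

theorem convex_asymptoticSumBound (u : ℕ → X) (n : ℕ) (c : ℝ) :
    Convex ℝ {y | AsymptoticSumBound u n c y} := by
  intro y hy y' hy' a b ha hb hab ε hε
  filter_upwards [hy ε hε, hy' ε hε] with i hi hi' A hA
  have h2 : ∑ k ∈ A, (u (i + k) - (a • y + b • y'))
      = a • ∑ k ∈ A, (u (i + k) - y) + b • ∑ k ∈ A, (u (i + k) - y') := by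
    rw [Finset.smul_sum, Finset.smul_sum, ← Finset.sum_add_distrib]
    refine Finset.sum_congr rfl fun k _ => ?_
    have : u (i + k) = (a + b) • u (i + k) := by rw [hab, one_smul]
    rw [smul_sub, smul_sub]
    nth_rw 1 [this]
    rw [add_smul]
    abel
  rw [h2]
  calc _ ≤ ‖a • ∑ k ∈ A, (u (i + k) - y)‖ + ‖b • ∑ k ∈ A, (u (i + k) - y')‖ := norm_add_le _ _
    _ ≤ a * (c + ε) + b * (c + ε) := by
      rw [norm_smul, norm_smul, Real.norm_of_nonneg ha, Real.norm_of_nonneg hb]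
      gcongr
      · exact hi A hA
      · exact hi' A hA
    _ = c + ε := by rw [← add_mul, hab, one_mul]

/-- Test the full sum over `{1, …, n}` against a functional norming `z - y`: by weak convergence,
each of the `n` terms tends to `‖z - y‖`. -/
theorem AsymptoticSumBound.mul_norm_sub_le {u : ℕ → X} {n : ℕ} {c : ℝ} {y z : X}
    (h : AsymptoticSumBound u n c y)
    (hz : ∀ f : StrongDual ℝ X, Tendsto (fun i => f (u i)) atTop (𝓝 (f z))) :
    n * ‖z - y‖ ≤ c := by
  obtain ⟨f, hf1, hf2⟩ := exists_dual_vector'' ℝ (z - y)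
  refine le_of_forall_pos_le_add fun ε hε => ?_
  have hlim : Tendsto (fun i => ∑ k ∈ Finset.Icc 1 n, f (u (i + k) - y)) atTop
      (𝓝 (∑ _k ∈ Finset.Icc 1 n, f (z - y))) := by
    refine tendsto_finsetSum _ fun k _ => ?_
    simp only [map_sub]
    exact ((hz f).comp (tendsto_add_atTop_nat k)).sub_const _
  have hsum : ∑ _k ∈ Finset.Icc 1 n, f (z - y) = n * ‖z - y‖ := by simp [hf2]
  rw [hsum] at hlim
  refine le_of_tendsto hlim ?_
  filter_upwards [h ε hε] with i hi
  rw [← map_sum]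
  calc _ ≤ ‖f (∑ k ∈ Finset.Icc 1 n, (u (i + k) - y))‖ := le_abs_self _
    _ ≤ 1 * ‖∑ k ∈ Finset.Icc 1 n, (u (i + k) - y)‖ := f.le_of_opNorm_le hf1 _
    _ ≤ c + ε := by rw [one_mul]; exact hi _ subset_rfl

/-- If the weak fixed point property for `𝔠𝔪`-nonexpansive maps fails, there is a bounded weakly
null sequence whose partial sums along every subsequence grow linearly. -/
theorem exists_weaklyNull_of_not_hasWeakFPP (hX : ¬ HasWeakFPPForCMNonexpansive X) :
    ∃ (w : ℕ → X) (δ : ℝ), 0 < δ ∧ (∃ R, ∀ i, ‖w i‖ ≤ R) ∧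
      (∀ f : StrongDual ℝ X, Tendsto (fun i => f (w i)) atTop (𝓝 0)) ∧
      ∀ (φ : ℕ → ℕ), StrictMono φ → ∀ n : ℕ, ∃ᶠ i in atTop, ∃ A ⊆ Finset.Icc 1 n,
        n * δ ≤ ‖∑ k ∈ A, w (φ (i + k))‖ := by
  simp only [HasWeakFPPForCMNonexpansive, not_forall] at hX
  obtain ⟨C, hCne, hCconv, hCcomp, T, hT, hTfix⟩ := hX
  let S : X → X := Function.extend ((↑) : C → X) (fun c => (T c : X)) id
  have hST : ∀ c : C, S c = T c := fun c => Subtype.val_injective.extend_apply _ _ c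
  have hSC : Set.MapsTo S C C := fun x hx => by
    rw [hST ⟨x, hx⟩]; exact (T ⟨x, hx⟩).2
  have hlip : ∀ x ∈ C, ∀ y ∈ C, ‖S x - S y‖ ≤ ‖x - y‖ := fun x hx y hy => by
    rw [hST ⟨x, hx⟩, hST ⟨y, hy⟩, ← dist_eq_norm, ← dist_eq_norm]
    simpa [Subtype.dist_eq] using hT.1.dist_le_mul ⟨x, hx⟩ ⟨y, hy⟩
  obtain ⟨K, hKC, hKne, hKconv, hKcl, hSK, hmin⟩ :=
    exists_minimal_invariant hCne hCconv hCcomp hSC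
  obtain ⟨R, hR⟩ := exists_norm_le_of_isCompact_toWeakSpace hCcomp
  have happ : ∀ j : ℕ, ∃ x ∈ K, ‖S x - x‖ < 1 / ((j : ℝ) + 1) := fun j =>
    exists_norm_sub_lt_of_nonexpansive hKne hKconv (fun x hx => hR x (hKC hx)) hSK
      (fun x hx y hy => hlip x (hKC hx) y (hKC hy)) (by positivity)
  choose u huK hu using happ
  have hSu : Tendsto (fun i => u i - S (u i)) atTop (𝓝 0) := by
    refine squeeze_zero_norm (fun i => ?_) tendsto_one_div_add_atTop_nhds_zero_nat
    rw [norm_sub_rev]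
    exact (hu i).le
  have hKcomp : IsCompact (toWeakSpace ℝ X '' K) :=
    hCcomp.of_isClosed_subset (hKconv.isClosed_toWeakSpace hKcl) (Set.image_mono hKC)
  obtain ⟨z, hzK, ψ, hψ, hz⟩ := exists_subseq_weakly_tendsto hKcomp huK
  have hSz : S z ≠ z := fun h => hTfix ⟨⟨z, hKC hzK⟩, Subtype.ext (by rw [← hST]; exact h)⟩
  have hd : 0 < ‖z - S z‖ := norm_pos_iff.2 (sub_ne_zero.2 hSz.symm)
  refine ⟨fun i => u (ψ i) - z, ‖z - S z‖ / 2, by positivity, ⟨R + R, fun i => ?_⟩, fun f => ?_,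
    fun φ hφ n => ?_⟩
  · exact (norm_sub_le _ _).trans (add_le_add (hR _ (hKC (huK _))) (hR _ (hKC hzK)))
  · simpa using (hz f).sub_const (f z)
  · rcases Nat.eq_zero_or_pos n with rfl | hn
    · exact Frequently.of_forall fun i => ⟨∅, by simp, by simp⟩
    by_contra hcon
    rw [not_frequently] at hcon
    push Not at hcon
    have hn' : (0 : ℝ) < n := by exact_mod_cast hn
    set c : ℝ := n * (‖z - S z‖ / 2) with hc
    have hc0 : 0 ≤ c := by positivity
    let v : ℕ → X := fun i => u (ψ (φ i))
    have hvK : ∀ i, v i ∈ K := fun i => huK _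
    have hQz : AsymptoticSumBound v n c z := by
      intro ε hε
      filter_upwards [hcon] with i hi A hA
      linarith [hi A hA]
    -- Invariance: the `𝔠𝔪` condition bounds the sums of `S (v i) - S y`, and `S (v i)` may be
    -- replaced by `v i` because `v i - S (v i)` tends to zero.
    have hQ : K ∩ {y | AsymptoticSumBound v n c y} = K := by
      refine hmin _ Set.inter_subset_left ⟨z, hzK, hQz⟩
        (hKconv.inter (convex_asymptoticSumBound _ _ _))
        (hKcl.inter (isClosed_asymptoticSumBound _ _ _)) ?_
      rintro y ⟨hyK, hy⟩
      refine ⟨hSK hyK, ?_⟩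
      have h1 := hT.asymptoticSumBound (u := fun i => ⟨v i, hKC (hvK i)⟩) (y := ⟨y, hKC hyK⟩) hc0 hy
      simp only [← hST] at h1
      exact h1.of_tendsto_sub (hSu.comp (hψ.comp hφ).tendsto_atTop)
    have hSzQ : S z ∈ K ∩ {y | AsymptoticSumBound v n c y} := by rw [hQ]; exact hSK hzK
    -- This reads `n * ‖z - S z‖ ≤ n * (‖z - S z‖ / 2)`, impossible for `n > 0`.
    have := hSzQ.2.mul_norm_sub_le fun f => (hz f).comp hφ.tendsto_atTop
    rw [hc] at this
    have := le_of_mul_le_mul_left this hn'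
    linarith

end CMNonexpansive

/-! ### A Ramsey theorem from iterated ultrafilter limits -/

section IteratedLimits

theorem Ultrafilter.exists_tendsto_of_abs_le {ι : Type*} (U : Ultrafilter ι) {g : ι → ℝ} {B : ℝ}
    (hg : ∀ i, |g i| ≤ B) : ∃ L, |L| ≤ B ∧ Tendsto g U (𝓝 L) := by
  obtain ⟨L, hL, hUL⟩ := (isCompact_Icc (a := -B) (b := B)).ultrafilter_le_nhds' (U.map g)
    (Ultrafilter.mem_map.2 (univ_mem' fun i => abs_le.1 (hg i)))
  exact ⟨L, abs_le.2 hL, hUL⟩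

/-- The `r`-fold iterated limit, along a nonprincipal ultrafilter, of the values of `f` at the
extensions of the list `s` by `r` entries. -/
noncomputable def iteratedLim (f : List ℕ → ℝ) : ℕ → List ℕ → ℝ
  | 0, s => f s
  | r + 1, s => limUnder (hyperfilter ℕ : Filter ℕ) fun k => iteratedLim f r (s ++ [k])

theorem abs_iteratedLim_le {f : List ℕ → ℝ} {B : ℝ} (hf : ∀ s, |f s| ≤ B) (r : ℕ) (s : List ℕ) :
    |iteratedLim f r s| ≤ B := by
  induction r generalizing s with
  | zero => exact hf s
  | succ r ih =>
    obtain ⟨L, hL, hlim⟩ := (hyperfilter ℕ).exists_tendsto_of_abs_le fun k => ih (s ++ [k])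
    rw [iteratedLim, hlim.limUnder_eq]
    exact hL

theorem tendsto_iteratedLim {f : List ℕ → ℝ} {B : ℝ} (hf : ∀ s, |f s| ≤ B) (r : ℕ) (s : List ℕ) :
    Tendsto (fun k => iteratedLim f r (s ++ [k])) (hyperfilter ℕ)
      (𝓝 (iteratedLim f (r + 1) s)) := by
  obtain ⟨L, -, hlim⟩ := (hyperfilter ℕ).exists_tendsto_of_abs_le
    fun k => abs_iteratedLim_le hf r (s ++ [k])
  exact tendsto_nhds_limUnder ⟨L, hlim⟩

theorem finite_setOf_list_le (l m : ℕ) :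
    {s : List ℕ | s.length ≤ l ∧ ∀ a ∈ s, a ≤ m}.Finite := by
  refine ((List.finite_length_le (Fin (m + 1)) l).image (List.map Fin.val)).subset ?_
  rintro s ⟨hs, hsm⟩
  refine ⟨s.pmap (fun a h => ⟨a, h⟩) fun a ha => Nat.lt_succ_of_le (hsm a ha), ?_, ?_⟩
  · simpa using hs
  · simp [List.map_pmap]

/-- A Ramsey type theorem: for countably many bounded functions of finite lists there is a
subsequence along whose increasing tuples, far enough out, all the functions are nearly constant. -/
theorem exists_subseq_forall_tuple_near {f : ℕ → List ℕ → ℝ} {B : ℕ → ℝ}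
    (hf : ∀ j s, |f j s| ≤ B j) :
    ∃ φ : ℕ → ℕ, StrictMono φ ∧ ∀ j n, ∃ L : ℝ, ∀ ε : ℝ, 0 < ε → ∃ n₀ : ℕ,
      ∀ κ : Fin n → ℕ, StrictMono κ → (∀ i, n₀ ≤ κ i) →
        |f j (List.ofFn fun i => φ (κ i)) - L| ≤ ε := by
  -- Only finitely many triples `(j, r, s)` matter at stage `i`, so a single `k` can come close to
  -- all the limits at once.
  have hstep : ∀ i m : ℕ, ∃ k, m < k ∧ ∀ j ≤ i, ∀ r ≤ i, ∀ s : List ℕ,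
      s.length ≤ i ∧ (∀ a ∈ s, a ≤ m) →
        |iteratedLim (f j) r (s ++ [k]) - iteratedLim (f j) (r + 1) s| < 1 / ((i : ℝ) + 1) := by
    intro i m
    have h1 : ∀ᶠ k in (hyperfilter ℕ : Filter ℕ), m < k :=
      Nat.hyperfilter_le_atTop (eventually_gt_atTop m)
    have h2 : ∀ᶠ k in (hyperfilter ℕ : Filter ℕ), ∀ j ∈ Set.Iic i, ∀ r ∈ Set.Iic i,
        ∀ s ∈ {s : List ℕ | s.length ≤ i ∧ ∀ a ∈ s, a ≤ m},
        |iteratedLim (f j) r (s ++ [k]) - iteratedLim (f j) (r + 1) s| < 1 / ((i : ℝ) + 1) := by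
      rw [eventually_all_finite (Set.finite_Iic i)]
      intro j _
      rw [eventually_all_finite (Set.finite_Iic i)]
      intro r _
      rw [eventually_all_finite (finite_setOf_list_le i m)]
      intro s _
      have := (tendsto_iteratedLim (hf j) r s).eventually
        (Metric.ball_mem_nhds _ (show (0 : ℝ) < 1 / ((i : ℝ) + 1) by positivity))
      simpa [Real.dist_eq] using this
    exact (h1.and h2).exists
  choose step hlt hclose using hstep
  let φ : ℕ → ℕ := fun i => Nat.rec 0 (fun i m => step i m) i
  have hφs : ∀ i, φ (i + 1) = step i (φ i) := fun i => rfl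
  have hφ : StrictMono φ := strictMono_nat_of_lt_succ fun i => by rw [hφs]; exact hlt _ _
  refine ⟨φ, hφ, fun j n => ⟨iteratedLim (f j) n [], fun ε hε => ?_⟩⟩
  obtain ⟨N, hN⟩ := exists_nat_gt ((n : ℝ) / ε)
  -- The `+ 1` lets each `κ p` be written `i + 1`, so that `φ (κ p)` was chosen at a stage `i`
  -- already handling `j`, lists of length at most `n`, and error `1 / (N + 1)`.
  refine ⟨max N (max j n) + 1, fun κ hκ hκN => ?_⟩
  set l := List.ofFn fun i => φ (κ i) with hl
  have hlen : l.length = n := by simp [hl]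
  -- The limits are replaced by actual entries one at a time, each costing at most `1 / (N + 1)`; at
  -- `p = n` no limit remains.
  have key : ∀ p ≤ n, |iteratedLim (f j) (n - p) (l.take p) - iteratedLim (f j) n []|
      ≤ p * (1 / ((N : ℝ) + 1)) := by
    intro p
    induction p with
    | zero => intro _; simp
    | succ p ih =>
      intro hp
      have ih := ih (by omega)
      have hpl : p < l.length := by omega
      have htake : l.take (p + 1) = l.take p ++ [φ (κ ⟨p, hp⟩)] := by
        rw [← List.take_append_getElem hpl]
        simp [hl]
      have hnp : n - p = n - (p + 1) + 1 := by omega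
      obtain ⟨i, hi⟩ : ∃ i, κ ⟨p, hp⟩ = i + 1 :=
        ⟨κ ⟨p, hp⟩ - 1, by have := hκN ⟨p, hp⟩; omega⟩
      have hiN := hκN ⟨p, hp⟩
      rw [hi] at hiN
      have h1 := hclose i (φ i) j (by omega) (n - (p + 1)) (by omega) (l.take p)
        ⟨by simp only [List.length_take]; omega, fun a ha => by
          obtain ⟨q, hq, rfl⟩ := List.mem_iff_getElem.1 ha
          simp only [List.length_take] at hq
          simp only [List.getElem_take, hl, List.getElem_ofFn]
          refine hφ.monotone (Nat.lt_succ_iff.1 ?_)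
          rw [Nat.succ_eq_add_one, ← hi]
          exact hκ (by simp only [Fin.mk_lt_mk]; omega)⟩
      rw [← hφs, ← hi, ← htake, ← hnp] at h1
      have h2 : 1 / ((i : ℝ) + 1) ≤ 1 / ((N : ℝ) + 1) := by
        have : (N : ℝ) ≤ i := by exact_mod_cast (show N ≤ i by omega)
        gcongr
      have := abs_sub_le (iteratedLim (f j) (n - (p + 1)) (l.take (p + 1)))
        (iteratedLim (f j) (n - p) (l.take p)) (iteratedLim (f j) n [])
      push_cast
      linarith
  have := key n le_rfl
  rw [Nat.sub_self, ← hlen, List.take_length, hlen] at this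
  refine this.trans ?_
  rw [div_lt_iff₀ hε] at hN
  rw [mul_one_div, div_le_iff₀ (by positivity)]
  nlinarith

end IteratedLimits

/-! ### Extraction of an asymptotically spreading subsequence -/

section SpreadingModel

variable {X : Type*} [NormedAddCommGroup X] [NormedSpace ℝ X]

theorem abs_norm_sum_smul_sub_le {n : ℕ} {x : Fin n → X} {R η : ℝ} (hx : ∀ i, ‖x i‖ ≤ R)
    {a b : Fin n → ℝ} (hab : ∀ i, |a i - b i| ≤ η) :
    |‖∑ i, a i • x i‖ - ‖∑ i, b i • x i‖| ≤ n * (η * R) := by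
  refine (abs_norm_sub_norm_le _ _).trans ?_
  rw [← Finset.sum_sub_distrib]
  calc _ ≤ ∑ i, ‖a i • x i - b i • x i‖ := norm_sum_le _ _
    _ ≤ ∑ _i : Fin n, η * R := Finset.sum_le_sum fun i _ => by
      rw [← sub_smul, norm_smul, Real.norm_eq_abs]
      exact mul_le_mul (hab i) (hx i) (norm_nonneg _) ((abs_nonneg _).trans (hab i))
    _ = _ := by simp

/-- The norms of the linear combinations of `n` increasing terms of the sequence stabilize, far
enough out, uniformly for coefficients in `[-1, 1]`. -/
def IsAsymptoticallySpreading (x : ℕ → X) : Prop :=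
  ∀ (n : ℕ) (ε : ℝ), 0 < ε → ∃ n₀ : ℕ, ∀ κ κ' : Fin n → ℕ, StrictMono κ → StrictMono κ' →
    (∀ i, n₀ ≤ κ i) → (∀ i, n₀ ≤ κ' i) → ∀ a : Fin n → ℝ, (∀ i, a i ∈ Set.Icc (-1 : ℝ) 1) →
      |‖∑ i, a i • x (κ i)‖ - ‖∑ i, a i • x (κ' i)‖| < ε

/-- The Ramsey theorem handles the countably many rational coefficient tuples. Uniformity over `[-1,
1]` comes from rounding to a finite grid of mesh `1 / N`. -/
theorem exists_subseq_isAsymptoticallySpreading {x : ℕ → X} {R : ℝ} (hx : ∀ i, ‖x i‖ ≤ R) :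
    ∃ φ : ℕ → ℕ, StrictMono φ ∧ IsAsymptoticallySpreading (x ∘ φ) := by
  have hR : 0 ≤ R := (norm_nonneg _).trans (hx 0)
  obtain ⟨g, hg⟩ := exists_surjective_nat (Σ n : ℕ, Fin n → ℚ)
  -- The default `0` is never read on the lists used below, whose length is `t.1`.
  let F : (Σ n : ℕ, Fin n → ℚ) → List ℕ → ℝ := fun t s =>
    ‖∑ i : Fin t.1, (t.2 i : ℝ) • x (s.getD i 0)‖
  obtain ⟨φ, hφ, h⟩ := exists_subseq_forall_tuple_near (f := fun j => F (g j))
    (B := fun j => ∑ i, |((g j).2 i : ℝ)| * R) (fun j s => by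
      rw [abs_of_nonneg (norm_nonneg _)]
      refine (norm_sum_le _ _).trans (Finset.sum_le_sum fun i _ => ?_)
      rw [norm_smul, Real.norm_eq_abs]
      exact mul_le_mul_of_nonneg_left (hx _) (abs_nonneg _))
  refine ⟨φ, hφ, fun n ε hε => ?_⟩
  have hrat : ∀ b : Fin n → ℚ, ∀ᶠ n₀ in atTop, ∀ κ κ' : Fin n → ℕ, StrictMono κ →
      StrictMono κ' → (∀ i, n₀ ≤ κ i) → (∀ i, n₀ ≤ κ' i) →
      |‖∑ i, (b i : ℝ) • x (φ (κ i))‖ - ‖∑ i, (b i : ℝ) • x (φ (κ' i))‖| ≤ ε / 2 := by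
    intro b
    obtain ⟨j, hj⟩ := hg ⟨n, b⟩
    obtain ⟨L, hL⟩ := h j n
    obtain ⟨n₀, hn₀⟩ := hL (ε / 4) (by positivity)
    rw [hj] at hn₀
    have hF : ∀ κ : Fin n → ℕ, F ⟨n, b⟩ (List.ofFn fun i => φ (κ i))
        = ‖∑ i, (b i : ℝ) • x (φ (κ i))‖ := by
      intro κ
      simp [F]
    filter_upwards [eventually_ge_atTop n₀] with m hm κ κ' hκ hκ' hmκ hmκ'
    have h1 := hn₀ κ hκ fun i => hm.trans (hmκ i)
    have h2 := hn₀ κ' hκ' fun i => hm.trans (hmκ' i)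
    rw [hF] at h1 h2
    rw [abs_le] at h1 h2 ⊢
    constructor <;> linarith
  obtain ⟨N, hN⟩ := exists_nat_gt (n * R * 8 / ε)
  have hNpos : (0 : ℝ) < N := lt_of_le_of_lt (by positivity) hN
  have hall := eventually_all.2 fun b : Fin n → Finset.Icc (-(N : ℤ)) N =>
    hrat fun i => ((b i : ℤ) : ℚ) / N
  obtain ⟨n₀, hn₀⟩ := hall.exists
  refine ⟨n₀, fun κ κ' hκ hκ' hn hn' a ha => ?_⟩
  let b : Fin n → Finset.Icc (-(N : ℤ)) N := fun i => ⟨⌊a i * N⌋, by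
    rw [Finset.mem_Icc, Int.le_floor, Int.floor_le_iff]
    push_cast
    constructor
    · nlinarith [(ha i).1]
    · nlinarith [(ha i).2]⟩
  have hab : ∀ i, |a i - ((((b i : ℤ) : ℚ) / N : ℚ) : ℝ)| ≤ 1 / N := by
    intro i
    push_cast
    have h1 : a i - (⌊a i * N⌋ : ℝ) / N = (a i * N - ⌊a i * N⌋) / N := by field_simp
    rw [show ((b i : ℤ) : ℝ) = (⌊a i * N⌋ : ℝ) from rfl, h1, abs_of_nonneg
      (div_nonneg (by linarith [Int.floor_le (a i * N)]) hNpos.le)]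
    gcongr
    linarith [Int.lt_floor_add_one (a i * N)]
  have h1 := hn₀ b κ κ' hκ hκ' hn hn'
  have h2 := abs_norm_sum_smul_sub_le (x := fun i => x (φ (κ i))) (fun i => hx _) hab
  have h3 := abs_norm_sum_smul_sub_le (x := fun i => x (φ (κ' i))) (fun i => hx _) hab
  have h4 : n * (1 / N * R) < ε / 8 := by
    rw [div_lt_iff₀ hε] at hN
    rw [show n * (1 / N * R) = n * R / N by ring, div_lt_iff₀ hNpos]
    linarith
  simp only [Function.comp_apply]
  rw [abs_le] at h1 h2 h3
  rw [abs_lt]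
  constructor <;> linarith

end SpreadingModel

/-! ### The generated seminorm and its lower `ℓ₁`-estimate -/

section GeneratedSeminorm

variable {X : Type*} [NormedAddCommGroup X] [NormedSpace ℝ X]
variable {V : Type*} [AddCommGroup V] [Module ℝ V]

/-- The seminorm `p` is asymptotically generated, on the linear combinations of the vectors `e i`,
by the norms of the linear combinations of increasing terms of the sequence `x`. -/
def Seminorm.IsGeneratedBy (p : Seminorm ℝ V) (e : ℕ → V) (x : ℕ → X) : Prop :=
  ∀ (n : ℕ) (ε : ℝ), 0 < ε → ∃ n₀ : ℕ, ∀ κ : Fin n → ℕ, StrictMono κ → (∀ i, n₀ ≤ κ i) →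
    ∀ a : Fin n → ℝ, (∀ i, a i ∈ Set.Icc (-1 : ℝ) 1) →
      |‖∑ i, a i • x (κ i)‖ - p (∑ i, a i • e i)| < ε

/-- The limit along an ultrafilter of a family of seminorms bounded by a norm. -/
theorem exists_seminorm_tendsto {ι : Type*} {V : Type*} [SeminormedAddCommGroup V]
    [NormedSpace ℝ V] (U : Ultrafilter ι) (q : ι → Seminorm ℝ V) {R : ℝ}
    (hq : ∀ i a, q i a ≤ R * ‖a‖) :
    ∃ p : Seminorm ℝ V, (∀ a, p a ≤ R * ‖a‖) ∧ ∀ a, Tendsto (fun i => q i a) U (𝓝 (p a)) := by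
  have hlim : ∀ a, ∃ L, Tendsto (fun i => q i a) U (𝓝 L) := fun a => by
    obtain ⟨L, -, hL⟩ := U.exists_tendsto_of_abs_le (g := fun i => q i a) (B := R * ‖a‖)
      fun i => by rw [abs_of_nonneg (apply_nonneg _ _)]; exact hq i a
    exact ⟨L, hL⟩
  choose p hp using hlim
  refine ⟨Seminorm.of p (fun a b => ?_) (fun c a => ?_), fun a => ?_, hp⟩
  · exact le_of_tendsto_of_tendsto' (hp (a + b)) ((hp a).add (hp b)) fun i => map_add_le_add _ _ _
  · refine tendsto_nhds_unique (hp (c • a)) ?_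
    simp only [map_smul_eq_mul]
    exact (hp a).const_mul _
  · exact le_of_tendsto' (hp a) fun i => hq i a

theorem lp.sum_norm_le_norm (a : lp (fun _ : ℕ => ℝ) 1) (s : Finset ℕ) :
    ∑ i ∈ s, ‖a i‖ ≤ ‖a‖ := by
  simpa using lp.sum_rpow_le_norm_rpow (p := 1) (by simp) a s

/-- The seminorm is an ultrafilter limit of norms computed on the blocks `x m, …, x (2 * m - 1)`,
defined on all of `ℓ₁` at once. On vectors supported in the first `n` coordinates, late blocks agree
up to `ε / 2` with any other late tuple. -/
theorem IsAsymptoticallySpreading.exists_seminorm {x : ℕ → X} {R : ℝ} (hx : ∀ i, ‖x i‖ ≤ R)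
    (h : IsAsymptoticallySpreading x) :
    ∃ p : Seminorm ℝ (lp (fun _ : ℕ => ℝ) 1), (∀ a, p a ≤ R * ‖a‖) ∧
      p.IsGeneratedBy (fun i => lp.single 1 i (1 : ℝ)) x := by
  have hR : 0 ≤ R := (norm_nonneg _).trans (hx 0)
  let q : ℕ → Seminorm ℝ (lp (fun _ : ℕ => ℝ) 1) := fun m =>
    Seminorm.of (fun a => ‖∑ i ∈ Finset.range m, a i • x (m + i)‖)
      (fun a b => by
        refine le_of_eq_of_le ?_ (norm_add_le _ _)
        rw [← Finset.sum_add_distrib]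
        simp [add_smul])
      (fun c a => by
        rw [← norm_smul, Finset.smul_sum]
        simp [smul_smul])
  have hqa : ∀ m a, q m a = ‖∑ i ∈ Finset.range m, a i • x (m + i)‖ := fun _ _ => rfl
  obtain ⟨p, hpR, hp⟩ := exists_seminorm_tendsto (hyperfilter ℕ) q (R := R) fun m a => by
    rw [hqa]
    calc _ ≤ ∑ i ∈ Finset.range m, ‖a i • x (m + i)‖ := norm_sum_le _ _
      _ ≤ ∑ i ∈ Finset.range m, ‖a i‖ * R := Finset.sum_le_sum fun i _ => by
        rw [norm_smul]
        exact mul_le_mul_of_nonneg_left (hx _) (norm_nonneg _)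
      _ = R * ∑ i ∈ Finset.range m, ‖a i‖ := by rw [← Finset.sum_mul, mul_comm]
      _ ≤ _ := mul_le_mul_of_nonneg_left (lp.sum_norm_le_norm a _) hR
  refine ⟨p, hpR, fun n ε hε => ?_⟩
  obtain ⟨n₀, hn₀⟩ := h n (ε / 2) (by positivity)
  refine ⟨n₀, fun κ hκ hκn a ha => ?_⟩
  have hlim := ((hp (∑ i, a i • lp.single 1 (i : ℕ) (1 : ℝ))).const_sub
    ‖∑ i, a i • x (κ i)‖).abs
  refine lt_of_le_of_lt (le_of_tendsto hlim ?_) (half_lt_self hε)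
  have hev : ∀ᶠ m in (hyperfilter ℕ : Filter ℕ), max n n₀ ≤ m :=
    Nat.hyperfilter_le_atTop (eventually_ge_atTop _)
  filter_upwards [hev] with m hm
  have hqm : q m (∑ i, a i • lp.single 1 (i : ℕ) (1 : ℝ)) = ‖∑ i : Fin n, a i • x (m + i)‖ := by
    have hcoe : ∀ k : ℕ, (∑ i : Fin n, a i • lp.single (E := fun _ : ℕ => ℝ) 1 (i : ℕ) (1 : ℝ)) k
        = if hk : k < n then a ⟨k, hk⟩ else 0 := by
      intro k
      rw [lp.coeFn_sum, Finset.sum_apply]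
      simp only [lp.coeFn_smul, Pi.smul_apply, lp.single_apply, smul_eq_mul]
      split_ifs with hk
      · rw [Finset.sum_eq_single ⟨k, hk⟩]
        · simp
        · intro i _ hi
          have : k ≠ i := fun h => hi (Fin.ext h.symm)
          simp [this]
        · simp
      · refine Finset.sum_eq_zero fun i _ => ?_
        have : k ≠ i := by have := i.2; omega
        simp [this]
    rw [hqa]
    congr 1
    obtain ⟨r, rfl⟩ : ∃ r, m = n + r := ⟨m - n, by omega⟩
    rw [Finset.sum_range_add, Finset.sum_range]
    simp only [hcoe]
    simp
  rw [hqm]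
  exact (hn₀ κ (fun i => m + i) hκ (fun i j hij => by simpa using hij) hκn
    (fun i => by omega) a ha).le

variable {p : Seminorm ℝ V} {e : ℕ → V} {x : ℕ → X}

/-- Homogeneity removes the restriction to coefficients in `[-1, 1]`, at the price of a threshold
depending on `a`. -/
theorem Seminorm.IsGeneratedBy.eventually_range (h : p.IsGeneratedBy e x) (n : ℕ) (a : ℕ → ℝ)
    {ε : ℝ} (hε : 0 < ε) :
    ∀ᶠ n₀ in atTop, ∀ κ : ℕ → ℕ, StrictMono κ → (∀ i, n₀ ≤ κ i) →
      |‖∑ i ∈ Finset.range n, a i • x (κ i)‖ - p (∑ i ∈ Finset.range n, a i • e i)| < ε := by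
  set M : ℝ := 1 + ∑ i ∈ Finset.range n, |a i| with hM
  have hMpos : 0 < M := by positivity
  obtain ⟨n₀, hn₀⟩ := h n (ε / M) (by positivity)
  filter_upwards [eventually_ge_atTop n₀] with m hm κ hκ hmκ
  have h1 := hn₀ (fun i => κ i) (fun i j hij => hκ hij) (fun i => hm.trans (hmκ i))
    (fun i => a i / M) (fun i => by
      refine abs_le.1 ?_
      rw [abs_div, abs_of_pos hMpos, div_le_one hMpos]
      have := Finset.single_le_sum (f := fun i => |a i|) (fun i _ => abs_nonneg _)
        (Finset.mem_range.2 i.2)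
      linarith)
  have e1 : ∑ i : Fin n, (a i / M) • x (κ i)
      = M⁻¹ • ∑ i ∈ Finset.range n, a i • x (κ i) := by
    rw [Finset.sum_range, Finset.smul_sum]
    simp only [smul_smul, div_eq_inv_mul]
  have e2 : ∑ i : Fin n, (a i / M) • e i = M⁻¹ • ∑ i ∈ Finset.range n, a i • e i := by
    rw [Finset.sum_range, Finset.smul_sum]
    simp only [smul_smul, div_eq_inv_mul]
  rw [e1, e2, norm_smul, map_smul_eq_mul, ← mul_sub, abs_mul, abs_norm, norm_inv,
    Real.norm_of_nonneg hMpos.le, div_eq_inv_mul] at h1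
  exact lt_of_mul_lt_mul_left h1 (by positivity)

theorem sum_range_shift {W : Type*} [AddCommGroup W] [Module ℝ W] (n t : ℕ) (a : ℕ → ℝ)
    (y : ℕ → W) :
    ∑ j ∈ Finset.range (t + n), (if j < t then 0 else a (j - t)) • y j
      = ∑ i ∈ Finset.range n, a i • y (t + i) := by
  rw [Finset.sum_range_add, Finset.sum_eq_zero, zero_add]
  · simp
  · intro j hj
    simp [Finset.mem_range.1 hj]

/-- Both values are approximated by the norm of the same vector `∑ a i • x (m + (t + i))`, read once
with `t` leading zero coefficients. -/
theorem Seminorm.IsGeneratedBy.shift (h : p.IsGeneratedBy e x) (n t : ℕ) (a : ℕ → ℝ) :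
    p (∑ i ∈ Finset.range n, a i • e (t + i)) = p (∑ i ∈ Finset.range n, a i • e i) := by
  refine eq_of_forall_dist_le fun ε hε => ?_
  obtain ⟨m, h1, h2⟩ := ((h.eventually_range (t + n) (fun j => if j < t then 0 else a (j - t))
    (half_pos hε)).and
    (h.eventually_range n a (half_pos hε))).exists
  have h1 := h1 (fun i => m + i) (fun i j hij => by simpa using hij) (fun i => by simp)
  have h2 := h2 (fun i => m + (t + i)) (fun i j hij => by simpa using hij) (fun i => by simp)
  rw [sum_range_shift, sum_range_shift] at h1
  rw [Real.dist_eq]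
  rw [abs_lt] at h1 h2
  rw [abs_le]
  constructor <;> linarith

/-- Mazur's theorem: a functional separating `0` from the closed convex hull of a tail would
contradict weak nullness. -/
theorem exists_mem_convexHull_norm_lt
    (hx : ∀ f : StrongDual ℝ X, Tendsto (fun i => f (x i)) atTop (𝓝 0)) (N : ℕ) {ε : ℝ}
    (hε : 0 < ε) : ∃ z ∈ convexHull ℝ (x '' Set.Ici N), ‖z‖ < ε := by
  by_contra! hcon
  have h0 : (0 : X) ∉ closure (convexHull ℝ (x '' Set.Ici N)) := fun h => by
    obtain ⟨z, hz, hz'⟩ := Metric.mem_closure_iff.1 h ε hε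
    rw [dist_zero_left] at hz'
    exact (hcon z hz).not_gt hz'
  obtain ⟨f, u, hu, hf⟩ := geometric_hahn_banach_point_closed
    (convex_convexHull ℝ (x '' Set.Ici N)).closure isClosed_closure h0
  rw [map_zero] at hu
  obtain ⟨k, hk, hkN⟩ := (((hx f).eventually (gt_mem_nhds hu)).and (eventually_ge_atTop N)).exists
  exact (hf _ (subset_closure (subset_convexHull ℝ _ ⟨k, hkN, rfl⟩))).not_gt hk

/-- A seminorm generated by a weakly null sequence does not increase when a coefficient is
dropped. -/
theorem Seminorm.IsGeneratedBy.update_zero_le (h : p.IsGeneratedBy e x)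
    (hx : ∀ f : StrongDual ℝ X, Tendsto (fun i => f (x i)) atTop (𝓝 0)) (n : ℕ) (a : ℕ → ℝ)
    (j : ℕ) :
    p (∑ i ∈ Finset.range n, Function.update a j 0 i • e i)
      ≤ p (∑ i ∈ Finset.range n, a i • e i) := by
  by_cases hj : j < n
  swap
  · refine le_of_eq (congrArg p (Finset.sum_congr rfl fun i hi => ?_))
    rw [Function.update_of_ne (by rintro rfl; exact hj (Finset.mem_range.1 hi))]
  refine le_of_forall_pos_le_add fun ε hε => ?_
  obtain ⟨m, h1, h2⟩ := ((h.eventually_range n a (ε := ε / 3) (by positivity)).and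
    (h.eventually_range n (Function.update a j 0) (ε := ε / 3) (by positivity))).exists
  obtain ⟨z, hz, hzε⟩ := exists_mem_convexHull_norm_lt hx (m + j)
    (ε := ε / (3 * (|a j| + 1))) (by positivity)
  rw [convexHull_eq_union_convexHull_finite_subsets] at hz
  simp only [Set.mem_iUnion] at hz
  obtain ⟨t, ht, hzt⟩ := hz
  have ht' : ∀ y ∈ t, ∃ k, m + j ≤ k ∧ x k = y := fun y hy => ht hy
  choose! k hk hkx using ht'
  obtain ⟨M, hM⟩ := (t.image k).bddAbove
  have hkM : ∀ y ∈ t, k y ≤ M := fun y hy => hM (by exact_mod_cast Finset.mem_image_of_mem k hy)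
  let N := M + m + j
  -- All indices but the `j`-th stay fixed while `l` runs through the gap from `m + j` to `N`. Each
  -- `v + a j • x l` has norm at most `c + ε / 3`; by convexity so has `v + a j • z`, and `a j • z`
  -- is negligible.
  let κ : ℕ → ℕ → ℕ := fun l i => if i < j then m + i else if i = j then l else N + i
  have hκ : ∀ l, m + j ≤ l → l ≤ N → StrictMono (κ l) := by
    intro l hl hlN i i' hii'
    simp only [κ]
    split_ifs <;> omega
  have hκm : ∀ l, m + j ≤ l → ∀ i, m ≤ κ l i := by
    intro l hl i
    simp only [κ, N]
    split_ifs <;> omega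
  set v : X := ∑ i ∈ Finset.range n, Function.update a j 0 i • x (κ N i) with hv
  have hsum : ∀ l, ∑ i ∈ Finset.range n, a i • x (κ l i) = v + a j • x l := by
    intro l
    rw [hv, ← Finset.add_sum_erase _ _ (Finset.mem_range.2 hj),
      ← Finset.add_sum_erase _ _ (Finset.mem_range.2 hj)]
    rw [Function.update_self, zero_smul, zero_add, add_comm]
    congr 1
    · refine Finset.sum_congr rfl fun i hi => ?_
      have hij := Finset.ne_of_mem_erase hi
      rw [Function.update_of_ne hij]
      simp [κ, hij]
    · simp [κ]
  set c := p (∑ i ∈ Finset.range n, a i • e i) with hc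
  have hconv : Convex ℝ {y : X | ‖v + a j • y‖ ≤ c + ε / 3} := by
    intro y hy y' hy' s s' hs hs' hss'
    have e1 : v + a j • (s • y + s' • y') = s • (v + a j • y) + s' • (v + a j • y') := by
      have : v = (s + s') • v := by rw [hss', one_smul]
      nth_rw 1 [this]
      simp only [smul_add, add_smul, smul_comm (a j)]
      abel
    simp only [Set.mem_ofPred_eq] at hy hy' ⊢
    rw [e1]
    calc _ ≤ ‖s • (v + a j • y)‖ + ‖s' • (v + a j • y')‖ := norm_add_le _ _
      _ ≤ s * (c + ε / 3) + s' * (c + ε / 3) := by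
        rw [norm_smul, norm_smul, Real.norm_of_nonneg hs, Real.norm_of_nonneg hs']
        gcongr
      _ = c + ε / 3 := by rw [← add_mul, hss', one_mul]
  have hzc : ‖v + a j • z‖ ≤ c + ε / 3 := by
    refine convexHull_min ?_ hconv hzt
    intro y hy
    have hkN : k y ≤ N := (hkM y hy).trans (by omega)
    have := h1 (κ (k y)) (hκ _ (hk y hy) hkN) (hκm _ (hk y hy))
    rw [hsum, hkx y hy] at this
    have := (abs_lt.1 this).2
    simp only [Set.mem_ofPred_eq]
    linarith
  have h3 := (abs_lt.1 (h2 (κ N) (hκ N (by omega) le_rfl) (hκm N (by omega)))).1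
  rw [← hv] at h3
  have h4 : ‖v‖ ≤ ‖v + a j • z‖ + ‖a j • z‖ := by simpa using norm_sub_le (v + a j • z) (a j • z)
  have h5 : ‖a j • z‖ ≤ ε / 3 := by
    rw [norm_smul, Real.norm_eq_abs]
    calc |a j| * ‖z‖ ≤ (|a j| + 1) * (ε / (3 * (|a j| + 1))) := by
          gcongr
          linarith
      _ = ε / 3 := by field_simp
  linarith

theorem Seminorm.IsGeneratedBy.indicator_le (h : p.IsGeneratedBy e x)
    (hx : ∀ f : StrongDual ℝ X, Tendsto (fun i => f (x i)) atTop (𝓝 0)) (n : ℕ) (a : ℕ → ℝ)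
    (P : ℕ → Prop) [DecidablePred P] :
    p (∑ i ∈ Finset.range n, (if P i then a i else 0) • e i)
      ≤ p (∑ i ∈ Finset.range n, a i • e i) := by
  have key : ∀ B : Finset ℕ, p (∑ i ∈ Finset.range n, (if i ∈ B then 0 else a i) • e i)
      ≤ p (∑ i ∈ Finset.range n, a i • e i) := by
    intro B
    induction B using Finset.induction_on with
    | empty => simp
    | insert j B hj ih =>
      refine le_trans (le_of_eq ?_)
        ((h.update_zero_le hx n (fun i => if i ∈ B then 0 else a i) j).trans ih)
      refine congrArg p (Finset.sum_congr rfl fun i _ => ?_)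
      by_cases hij : i = j
      · simp [hij]
      · simp [hij]
  refine le_trans (le_of_eq ?_) (key ((Finset.range n).filter fun i => ¬ P i))
  refine congrArg p (Finset.sum_congr rfl fun i hi => ?_)
  by_cases hP : P i <;> simp [hP, Finset.mem_range.1 hi]

theorem Seminorm.IsGeneratedBy.mul_le_sum (h : p.IsGeneratedBy e x)
    (hx : ∀ f : StrongDual ℝ X, Tendsto (fun i => f (x i)) atTop (𝓝 0)) {δ : ℝ} {n : ℕ}
    (hδ : ∃ᶠ i in atTop, ∃ A ⊆ Finset.Icc 1 n, n * δ ≤ ‖∑ k ∈ A, x (i + k)‖) :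
    n * δ ≤ p (∑ i ∈ Finset.range n, e i) := by
  refine le_of_forall_pos_le_add fun ε hε => ?_
  -- The threshold must be uniform in `A`, since the set supplied by `hδ` depends on `m`.
  have hev : ∀ᶠ m in atTop, ∀ A ∈ {A : Finset ℕ | A ⊆ Finset.Icc 1 n}, ∀ κ : ℕ → ℕ,
      StrictMono κ → (∀ i, m ≤ κ i) →
      |‖∑ i ∈ Finset.range (1 + n), (if i ∈ A then (1 : ℝ) else 0) • x (κ i)‖
        - p (∑ i ∈ Finset.range (1 + n), (if i ∈ A then (1 : ℝ) else 0) • e i)| < ε := by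
    have hfin : {A : Finset ℕ | A ⊆ Finset.Icc 1 n}.Finite := by
      refine (Finset.finite_toSet (Finset.Icc 1 n).powerset).subset fun A hA => ?_
      exact Finset.mem_coe.2 (Finset.mem_powerset.2 hA)
    rw [eventually_all_finite hfin]
    exact fun A _ => h.eventually_range _ _ hε
  obtain ⟨m, ⟨A, hA, hmA⟩, hm⟩ := (hδ.and_eventually hev).exists
  have h1 := hm A hA (fun i => m + i) (fun i j hij => by simpa using hij) (fun i => by simp)
  have hA' : A ⊆ Finset.range (1 + n) := fun i hi => by
    have := Finset.mem_Icc.1 (hA hi)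
    exact Finset.mem_range.2 (by omega)
  have e1 : ∑ i ∈ Finset.range (1 + n), (if i ∈ A then (1 : ℝ) else 0) • x (m + i)
      = ∑ k ∈ A, x (m + k) := by
    simp only [ite_smul, one_smul, zero_smul]
    rw [Finset.sum_ite_mem, Finset.inter_eq_right.2 hA']
  rw [e1] at h1
  have h2 : p (∑ i ∈ Finset.range (1 + n), (if i ∈ A then (1 : ℝ) else 0) • e i)
      ≤ p (∑ i ∈ Finset.range n, e i) := by
    have h3 := h.indicator_le hx (1 + n) (fun i => if 1 ≤ i then (1 : ℝ) else 0) (· ∈ A)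
    have h4 := h.shift n 1 fun _ => 1
    simp only [one_smul] at h4
    have h5 : ∑ i ∈ Finset.range (1 + n), (if 1 ≤ i then (1 : ℝ) else 0) • e i
        = ∑ i ∈ Finset.range n, e (1 + i) := by
      rw [Finset.sum_range_add]
      simp
    rw [h5, h4] at h3
    refine le_trans (le_of_eq ?_) h3
    refine congrArg p (Finset.sum_congr rfl fun i _ => ?_)
    by_cases hi : i ∈ A
    · simp [hi, (Finset.mem_Icc.1 (hA hi)).1]
    · simp [hi]
  linarith [(abs_lt.1 h1).2]

/-- Averaging over shifts: if the sums of the `e i` grow linearly, so do the linear combinations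
with nonnegative coefficients. -/
theorem Seminorm.IsGeneratedBy.mul_sum_le_of_nonneg (h : p.IsGeneratedBy e x)
    (hx : ∀ f : StrongDual ℝ X, Tendsto (fun i => f (x i)) atTop (𝓝 0)) {δ : ℝ}
    (hδ : ∀ n : ℕ, n * δ ≤ p (∑ i ∈ Finset.range n, e i)) (n : ℕ) {a : ℕ → ℝ}
    (ha : ∀ i, 0 ≤ a i) :
    δ * ∑ i ∈ Finset.range n, a i ≤ p (∑ i ∈ Finset.range n, a i • e i) := by
  set s := ∑ i ∈ Finset.range n, a i with hs
  set P := p (∑ i ∈ Finset.range n, a i • e i) with hP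
  have hs0 : 0 ≤ s := Finset.sum_nonneg fun i _ => ha i
  -- Add the `M + n` translates of `∑ a i • e i`, each of seminorm `P`. On the window `n ≤ q < n +
  -- M` every `a i` contributes exactly once, so the coefficient `c q` is `s`; dropping the rest
  -- leaves `s` times a sum of `M` consecutive vectors. Large `M` makes `n * P` negligible.
  have key : ∀ M : ℕ, s * (M * δ) ≤ (M + n) * P := by
    intro M
    let c : ℕ → ℝ := fun q =>
      ∑ t ∈ Finset.range (M + n), ∑ i ∈ Finset.range n, if t + i = q then a i else 0
    have hsum : ∑ t ∈ Finset.range (M + n), ∑ i ∈ Finset.range n, a i • e (t + i)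
        = ∑ q ∈ Finset.range (n + (M + n)), c q • e q := by
      simp only [c, Finset.sum_smul]
      rw [Finset.sum_comm (s := Finset.range (n + (M + n)))]
      refine Finset.sum_congr rfl fun t ht => ?_
      rw [Finset.sum_comm (s := Finset.range (n + (M + n)))]
      refine Finset.sum_congr rfl fun i hi => ?_
      simp only [ite_smul, zero_smul]
      rw [Finset.sum_ite_eq, if_pos]
      have := Finset.mem_range.1 ht
      have := Finset.mem_range.1 hi
      exact Finset.mem_range.2 (by omega)
    have hc : ∀ q, n ≤ q → q < n + M → c q = s := by
      intro q hq hqM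
      simp only [c]
      rw [Finset.sum_comm, hs]
      refine Finset.sum_congr rfl fun i hi => ?_
      have := Finset.mem_range.1 hi
      rw [Finset.sum_eq_single (q - i)]
      · rw [if_pos (by omega)]
      · intro t _ ht
        rw [if_neg (by omega)]
      · intro ht
        exact absurd (Finset.mem_range.2 (by omega)) ht
    have h1 : p (∑ q ∈ Finset.range (n + (M + n)), c q • e q) ≤ (M + n) * P := by
      rw [← hsum]
      refine (Finset.le_sum_of_subadditive p (map_zero p).le (map_add_le_add p) _ _).trans (le_of_eq ?_)
      rw [Finset.sum_congr rfl fun t _ => h.shift n t a]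
      simp [hP]
    have h2 := h.indicator_le hx (n + (M + n)) c fun q => n ≤ q ∧ q < n + M
    have h3 : ∑ q ∈ Finset.range (n + (M + n)), (if n ≤ q ∧ q < n + M then c q else 0) • e q
        = s • ∑ i ∈ Finset.range M, e (n + i) := by
      rw [Finset.sum_range_add, Finset.sum_range_add, Finset.sum_eq_zero, zero_add,
        add_comm (∑ i ∈ Finset.range M, _), Finset.sum_eq_zero, zero_add, Finset.smul_sum]
      · refine Finset.sum_congr rfl fun i hi => ?_
        have := Finset.mem_range.1 hi
        rw [if_pos ⟨by omega, by omega⟩, hc _ (by omega) (by omega)]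
      · intro i _
        rw [if_neg (by omega), zero_smul]
      · intro i hi
        have := Finset.mem_range.1 hi
        rw [if_neg (by omega), zero_smul]
    have h4 := h.shift M n fun _ => 1
    simp only [one_smul] at h4
    rw [h3, map_smul_eq_mul, Real.norm_of_nonneg hs0, h4] at h2
    exact (mul_le_mul_of_nonneg_left (hδ M) hs0).trans (h2.trans h1)
  by_contra! hlt
  obtain ⟨M, hM⟩ := exists_nat_gt (n * P / (δ * s - P))
  rw [div_lt_iff₀ (by linarith)] at hM
  nlinarith [key M]

/-- Deleting the negative coefficients bounds the positive part, and applying this to `-a` bounds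
the negative part; averaging the two costs the factor `1 / 2`. -/
theorem Seminorm.IsGeneratedBy.mul_sum_abs_le (h : p.IsGeneratedBy e x)
    (hx : ∀ f : StrongDual ℝ X, Tendsto (fun i => f (x i)) atTop (𝓝 0)) {δ : ℝ}
    (hδ : ∀ n : ℕ, n * δ ≤ p (∑ i ∈ Finset.range n, e i)) (n : ℕ) (a : ℕ → ℝ) :
    δ / 2 * ∑ i ∈ Finset.range n, |a i| ≤ p (∑ i ∈ Finset.range n, a i • e i) := by
  have hpos : ∀ b : ℕ → ℝ, δ * ∑ i ∈ Finset.range n, max (b i) 0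
      ≤ p (∑ i ∈ Finset.range n, b i • e i) := by
    intro b
    refine (h.mul_sum_le_of_nonneg hx hδ n fun i => le_max_right (b i) 0).trans ?_
    refine le_trans (le_of_eq ?_) (h.indicator_le hx n b fun i => 0 ≤ b i)
    refine congrArg p (Finset.sum_congr rfl fun i _ => ?_)
    split_ifs with hb
    · rw [max_eq_left hb]
    · rw [max_eq_right (not_le.1 hb).le]
  have h1 := hpos a
  have h2 := hpos fun i => -a i
  simp only [neg_smul, Finset.sum_neg_distrib, map_neg_eq_map] at h2
  have h3 : ∑ i ∈ Finset.range n, |a i|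
      = ∑ i ∈ Finset.range n, max (a i) 0 + ∑ i ∈ Finset.range n, max (-a i) 0 := by
    rw [← Finset.sum_add_distrib]
    refine Finset.sum_congr rfl fun i _ => ?_
    rcases le_total 0 (a i) with hi | hi
    · rw [abs_of_nonneg hi, max_eq_left hi, max_eq_right (by linarith), add_zero]
    · rw [abs_of_nonpos hi, max_eq_right hi, max_eq_left (by linarith), zero_add]
  rw [h3]
  linarith

end GeneratedSeminorm

/-! ### From the seminorm to a spreading model isomorphic to `ℓ₁` -/

section Main

variable {X : Type*} [NormedAddCommGroup X] [NormedSpace ℝ X]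

theorem lp.tendsto_sum_range_single (a : lp (fun _ : ℕ => ℝ) 1) :
    Tendsto (fun n => ∑ i ∈ Finset.range n, a i • lp.single (E := fun _ : ℕ => ℝ) 1 i (1 : ℝ))
      atTop (𝓝 a) := by
  have := (lp.hasSum_single (by simp) a).tendsto_sum_nat
  refine this.congr fun n => Finset.sum_congr rfl fun i _ => ?_
  rw [← lp.single_smul, smul_eq_mul, mul_one]

/-- A lower `ℓ₁`-estimate on the span of the unit vectors extends to `ℓ₁`. -/
theorem Seminorm.mul_norm_le_of_forall_sum {p : Seminorm ℝ (lp (fun _ : ℕ => ℝ) 1)} {R c : ℝ}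
    (hpR : ∀ a, p a ≤ R * ‖a‖) (hc : 0 ≤ c)
    (h : ∀ (n : ℕ) (a : ℕ → ℝ), c * ∑ i ∈ Finset.range n, |a i|
      ≤ p (∑ i ∈ Finset.range n, a i • lp.single 1 i (1 : ℝ)))
    (a : lp (fun _ : ℕ => ℝ) 1) : c * ‖a‖ ≤ p a := by
  have hlim := lp.tendsto_sum_range_single a
  have hp' : Tendsto (fun n => p (∑ i ∈ Finset.range n, a i • lp.single 1 i (1 : ℝ))) atTop
      (𝓝 (p a)) := by
    rw [tendsto_iff_dist_tendsto_zero]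
    have h0 := (tendsto_iff_norm_sub_tendsto_zero.1 hlim).const_mul R
    rw [mul_zero] at h0
    refine squeeze_zero (fun _ => dist_nonneg) (fun n => ?_) h0
    rw [Real.dist_eq]
    exact (abs_sub_map_le_sub p _ _).trans (hpR _)
  refine le_of_tendsto_of_tendsto' (hlim.norm.const_mul c) hp' fun n =>
    (mul_le_mul_of_nonneg_left ?_ hc).trans (h n a)
  refine (norm_sum_le _ _).trans (Finset.sum_le_sum fun i _ => ?_)
  rw [norm_smul, lp.norm_single (by simp), norm_one, mul_one, Real.norm_eq_abs]

/-- A subsequence of a bounded sequence generating a seminorm that is equivalent to the norm of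
`ℓ₁` yields a spreading model isomorphic to `ℓ₁`. -/
theorem hasSpreadingModelIsomorphicToL1_of_seminorm {V : Type} [AddCommGroup V] [Module ℝ V]
    (L : V ≃ₗ[ℝ] lp (fun _ : ℕ => ℝ) 1) (p : Seminorm ℝ V) {c R : ℝ} (hc : 0 < c)
    (hlow : ∀ a, c * ‖L a‖ ≤ p a) (hup : ∀ a, p a ≤ R * ‖L a‖) {x : ℕ → X}
    (hx : Bornology.IsBounded (Set.range x)) {φ : ℕ → ℕ} (hφ : StrictMono φ)
    (hgen : p.IsGeneratedBy (fun i => L.symm (lp.single 1 i (1 : ℝ))) (x ∘ φ)) :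
    HasSpreadingModelIsomorphicToL1 X := by
  -- `V` is a bare vector space here, so `p` can become its norm without clashing with the
  -- `ℓ₁`-norm, even when `V` is later taken to be `ℓ₁` itself.
  let _ : SeminormedAddCommGroup V := p.toAddGroupSeminorm.toSeminormedAddCommGroup
  have hnorm : ∀ a : V, ‖a‖ = p a := fun _ => rfl
  let _ : NormedSpace ℝ V := ⟨fun r a => by rw [hnorm, hnorm, map_smul_eq_mul]⟩
  have hL : Continuous L := by
    refine AddMonoidHomClass.continuous_of_bound L c⁻¹ fun a => ?_
    rw [hnorm, ← div_eq_inv_mul, le_div_iff₀ hc, mul_comm]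
    exact hlow a
  have hL' : Continuous L.symm := by
    refine AddMonoidHomClass.continuous_of_bound L.symm R fun a => ?_
    rw [hnorm]
    simpa using hup (L.symm a)
  let Φ : V ≃L[ℝ] lp (fun _ : ℕ => ℝ) 1 := ⟨L, hL, hL'⟩
  refine ⟨V, inferInstance, inferInstance, fun i => L.symm (lp.single 1 i (1 : ℝ)),
    ⟨?_, x, hx, φ, hφ, hgen⟩, Φ, fun i => L.apply_symm_apply _⟩
  rw [Submodule.eq_top_iff']
  intro a
  have hlim := (hL'.tendsto _).comp (lp.tendsto_sum_range_single (L a))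
  rw [L.symm_apply_apply] at hlim
  refine mem_closure_of_tendsto hlim (Eventually.of_forall fun n => ?_)
  simp only [Function.comp_apply, map_sum, map_smul]
  exact Submodule.sum_mem _ fun i _ => Submodule.smul_mem _ _ (Submodule.subset_span ⟨i, rfl⟩)

/-- A normed space failing the weak fixed point property for `𝔠𝔪`-nonexpansive maps has a
spreading model isomorphic to `ℓ₁`; neither completeness nor an approximation property is needed.
-/
theorem hasSpreadingModelIsomorphicToL1_of_not_hasWeakFPP
    (hX : ¬ HasWeakFPPForCMNonexpansive X) : HasSpreadingModelIsomorphicToL1 X := by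
  obtain ⟨w, δ, hδ, ⟨R, hR⟩, hw, hgrow⟩ := exists_weaklyNull_of_not_hasWeakFPP hX
  obtain ⟨φ, hφ, hspread⟩ := exists_subseq_isAsymptoticallySpreading hR
  obtain ⟨p, hpR, hgen⟩ := hspread.exists_seminorm fun i => hR (φ i)
  have hnull : ∀ f : StrongDual ℝ X, Tendsto (fun i => f ((w ∘ φ) i)) atTop (𝓝 0) := fun f =>
    (hw f).comp hφ.tendsto_atTop
  have hsum : ∀ n : ℕ, n * δ ≤ p (∑ i ∈ Finset.range n, lp.single 1 i (1 : ℝ)) := fun n =>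
    hgen.mul_le_sum hnull (hgrow φ hφ n)
  exact hasSpreadingModelIsomorphicToL1_of_seminorm (LinearEquiv.refl ℝ _) p (half_pos hδ)
    (Seminorm.mul_norm_le_of_forall_sum hpR (half_pos hδ).le (hgen.mul_sum_abs_le hnull hsum))
    hpR (isBounded_iff_forall_norm_le.2 ⟨R, by rintro _ ⟨i, rfl⟩; exact hR i⟩) hφ hgen

end Main

theorem mainTheorem1 {Z : Type*} [NormedAddCommGroup Z] [NormedSpace ℝ Z] [CompleteSpace Z]
    {D : Type*} [Preorder D] [IsDirectedOrder D] [Nonempty D]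
    (P : D → Z →L[ℝ] Z) (lam : ℝ) (hP : IsExtendedApproximativeBasis P lam) (hlam : lam < 2)
    (X : Submodule ℝ Z) (hX : ¬ HasWeakFPPForCMNonexpansive X) :
    HasSpreadingModelIsomorphicToL1 X :=
  hasSpreadingModelIsomorphicToL1_of_not_hasWeakFPP hX
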